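/- Setting. A graph $X=(V,E)$ consists of vertices, oriented edges, a fixed-point free involution $e\mapsto\bar e$ of $E$ and maps $e\mapsto e_\pm\in V$ with $\bar e_+=e_-$. Let $X$ be a finite connected graph, let $n\ge 0$, and let $(\mathcal G,X)$ be a graph of groups on $X$ all of whose vertex and edge groups are $\mathbb Z^n$, the monomorphism $\mathcal G_e\to \mathcal G_{e_+}$ being given by an integer matrix $\sigma_e$ with $\det\sigma_e\ne 0$. Fix a maximal tree $T$ in $X$, an orientation $A$ of $X$ and a base vertex $v_0$. Let $G=\pi_1(\mathcal G,X,T)$ be the Bass–Serre fundamental group: the quotient of the free product of the vertex groups and of the free group on $(t_e)_{e\in E}$ by the relations $t_e\sigma_e(g)t_e^{-1}=\sigma_{\bar e}(g)$ and $t_et_{\bar e}=1$ ($e\in E$, $g\in\mathbb Z^n$) and $t_e=1$ ($e\in T$). Let $G_v\subset G$ be the image of the vertex group at $v$ and $G_e\subset G_{e_+}$ the image of $\sigma_e(\mathbb Z^n)$. Let $\tilde X$ be the Bass–Serre tree, with vertex set $\coprod_v G/G_v$, edge set $\coprod_e G/G_e$, $(gG_e)_+=gG_{e_+}$, $\overline{gG_e}=gt_e^{-1}G_{\bar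 e}$ and $(gG_e)_-=gt_e^{-1}G_{e_-}$; let $\mathrm{Aut}(\tilde X)$ have the topology of pointwise convergence, and let $\iota:G\to\mathrm{Aut}(\tilde X)$ be the action by left translations. Let $H_d\subset G$ be the subgroup generated by the $t_e$, $e\in A\smallsetminus T$, with the discrete topology, and let $\varphi:G\to H_d$ be the homomorphism which is trivial on all $G_v$ and satisfies $\varphi(t_e)=t_e$. It extends uniquely to a continuous homomorphism $\bar\varphi:\overline{\iota(G)}\to H_d$ with $\bar\varphi\circ\iota=\varphi$. For $v\in V$, let $e_1,\dots,e_k$ be the edges, oriented from $v_0$ to $v$, of the geodesic from $v_0$ to $v$ in $T$, and put $\tau_v=\prod_{i=1}^k\sigma_{\bar e_i}\sigma_{e_i}^{-1}$ (ordered product). Let $\mu:G\to\mathbb R^n\rtimes \mathrm{GL}_n(\mathbb R)$ be the homomorphism given by the translation by $\tau_v g$ for $g$ in the vertex group at $v$, and by $\mu(t_e)=\tau_{e_-}\sigma_{\bar e}\sigma_e^{-1}\tau_{e_+}^{-1}\in\mathrm{GL}_n(\mathbb R)$. Let $H_d$ act on $\mathbb R^n$ through $\mu$, let $\nu:G\to\mathbb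 R^n\rtimes_\mu H_d$ be the homomorphism whose $\mathbb R^n$-component is that of $\mu$ and whose $H_d$-component is $\varphi$, let $\psi:\mathbb R^n\rtimes_\mu H_d\to H_d$ be the projection, and put $$W=\{(g,h)\in\overline{\iota(G)}\times(\mathbb R^n\rtimes_\mu H_d):\ \bar\varphi(g)=\psi(h)\}.$$ Proposition. The homomorphism $\iota\times\nu:G\to\mathrm{Aut}(\tilde X)\times(\mathbb R^n\rtimes_\mu H_d)$ is injective; its image is contained in $W$ and is a cocompact lattice in $W$, that is, a discrete subgroup of $W$ such that the quotient of $W$ by it is compact. Moreover the homomorphism $\iota\times\mu:G\to\mathrm{Aut}(\tilde X)\times(\mathbb R^n\rtimes\mathrm{GL}_n(\mathbb R))$ is proper, i.e. the preimage of every compact set is finite; a fortiori so is $G\to\overline{\iota(G)}\times(\mathbb R^n\rtimes\mu(H_d))$. -/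

import Mathlib

open Topology

noncomputable section

namespace GraphZn

/-! ### Graphs, walks, maximal trees, orientations -/

/-- A graph with vertex set `V` and set of oriented edges `E`: a fixed-point free involution
`bar` on `E` and the extremity map `plus`; the origin of `e` is the extremity of `bar e`.
Loops and multiple edges are allowed. -/
structure OGraph (V : Type*) (E : Type*) where
  bar : E → E
  plus : E → V
  bar_bar : ∀ e, bar (bar e) = e
  bar_ne : ∀ e, bar e ≠ e

namespace OGraph

variable {V E : Type*} (X : OGraph V E)

/-- The origin of an oriented edge. -/
def minus (e : E) : V := X.plus (X.bar e)

/-- `X.IsWalk v p w`: the list of oriented edges `p` is a path from `v` to `w`. -/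
def IsWalk : V → List E → V → Prop
  | v, [], w => v = w
  | v, e :: p, w => X.minus e = v ∧ IsWalk (X.plus e) p w

/-- A path without backtracking. -/
def IsReduced (p : List E) : Prop := p.IsChain (fun e f => f ≠ X.bar e)

/-- The graph is non-empty, and any two vertices are joined by a path. -/
def IsConnected : Prop := Nonempty V ∧ ∀ v w, ∃ p, X.IsWalk v p w

/-- A maximal tree of a connected graph, given by its set of (oriented) edges: a subgraph which
contains all vertices and in which any two vertices are joined by exactly one path without
backtracking. -/
structure MaxTree where
  edges : Set E
  bar_mem : ∀ e ∈ edges, X.bar e ∈ edges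
  existsUnique_path : ∀ v w, ∃! p, X.IsWalk v p w ∧ X.IsReduced p ∧ ∀ e ∈ p, e ∈ edges

/-- An orientation: a fundamental domain for the involution on the set of oriented edges. -/
structure Orientation where
  edges : Set E
  mem_iff : ∀ e, e ∈ edges ↔ X.bar e ∉ edges

lemma isWalk_append {u v w : V} {p q : List E} (hp : X.IsWalk u p v) (hq : X.IsWalk v q w) :
    X.IsWalk u (p ++ q) w := by
  induction p generalizing u with
  | nil => cases hp; exact hq
  | cons e p ih => exact ⟨hp.1, ih hp.2⟩

lemma isWalk_concat {u w : V} {p : List E} {e : E} (h : X.IsWalk u (p ++ [e]) w) :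
    X.IsWalk u p (X.minus e) ∧ X.plus e = w := by
  induction p generalizing u with
  | nil => exact ⟨h.1.symm, h.2⟩
  | cons f p ih => exact ⟨⟨h.1, (ih h.2).1⟩, (ih h.2).2⟩

/-! ### The automorphism group and its topology -/

/-- Pairs of permutations of the vertices and of the oriented edges which commute with the
extremity map and with the involution (hence with the origin map). -/
def autSubgroup : Subgroup (Equiv.Perm V × Equiv.Perm E) where
  carrier := {g | ∀ e, X.plus (g.2 e) = g.1 (X.plus e) ∧ X.bar (g.2 e) = g.2 (X.bar e)}
  one_mem' := fun _ => ⟨rfl, rfl⟩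
  mul_mem' := by
    intro a b ha hb e
    refine ⟨?_, ?_⟩
    · simp [(ha _).1, (hb _).1]
    · simp [(ha _).2, (hb _).2]
  inv_mem' := by
    intro a ha e
    have h := ha (a.2.symm e)
    rw [Equiv.apply_symm_apply] at h
    refine ⟨?_, ?_⟩
    · exact ((Equiv.symm_apply_eq _).2 h.1).symm
    · exact ((Equiv.symm_apply_eq _).2 h.2).symm

/-- The automorphism group of a graph. -/
def Aut : Type _ := X.autSubgroup

instance : Group X.Aut := inferInstanceAs (Group X.autSubgroup)

variable {X}

/-- The permutation of the vertices given by an automorphism. -/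
def Aut.onV (g : X.Aut) : Equiv.Perm V := g.1.1

/-- The permutation of the oriented edges given by an automorphism. -/
def Aut.onE (g : X.Aut) : Equiv.Perm E := g.1.2

@[simp] lemma Aut.onV_mul (g h : X.Aut) (v : V) : (g * h).onV v = g.onV (h.onV v) := rfl
@[simp] lemma Aut.onE_mul (g h : X.Aut) (e : E) : (g * h).onE e = g.onE (h.onE e) := rfl
@[simp] lemma Aut.onV_one (v : V) : (1 : X.Aut).onV v = v := rfl
@[simp] lemma Aut.onE_one (e : E) : (1 : X.Aut).onE e = e := rfl

variable (X)

/-- The topology of pointwise convergence (on the discrete sets of vertices and edges): the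
coarsest topology for which all maps `g ↦ g v` and `g ↦ g e` into discrete sets are continuous. -/
instance : TopologicalSpace X.Aut :=
  (⨅ v : V, TopologicalSpace.induced (fun g : X.Aut => g.onV v) ⊥) ⊓
    (⨅ e : E, TopologicalSpace.induced (fun g : X.Aut => g.onE e) ⊥)

lemma isOpen_onV (v w : V) : IsOpen {g : X.Aut | g.onV v = w} := by
  have h : (inferInstance : TopologicalSpace X.Aut) ≤
      TopologicalSpace.induced (fun g : X.Aut => g.onV v) ⊥ := inf_le_left.trans (iInf_le _ v)
  apply h
  exact ⟨{w}, trivial, rfl⟩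

lemma isOpen_onE (e f : E) : IsOpen {g : X.Aut | g.onE e = f} := by
  have h : (inferInstance : TopologicalSpace X.Aut) ≤
      TopologicalSpace.induced (fun g : X.Aut => g.onE e) ⊥ := inf_le_right.trans (iInf_le _ e)
  apply h
  exact ⟨{f}, trivial, rfl⟩

lemma continuous_to_aut {S : Type*} [TopologicalSpace S] {f : S → X.Aut}
    (hV : ∀ v w, IsOpen {s | (f s).onV v = w}) (hE : ∀ e e', IsOpen {s | (f s).onE e = e'}) :
    Continuous f := by
  refine continuous_inf_rng.2 ⟨continuous_iInf_rng.2 fun v => continuous_induced_rng.2 ?_,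
    continuous_iInf_rng.2 fun e => continuous_induced_rng.2 ?_⟩
  · let _ : TopologicalSpace V := ⊥
    have _ : DiscreteTopology V := ⟨rfl⟩
    exact continuous_discrete_rng.2 fun w => hV v w
  · let _ : TopologicalSpace E := ⊥
    have _ : DiscreteTopology E := ⟨rfl⟩
    exact continuous_discrete_rng.2 fun w => hE e w

instance : IsTopologicalGroup X.Aut where
  continuous_mul := by
    apply continuous_to_aut
    · intro v w
      have : {s : X.Aut × X.Aut | (s.1 * s.2).onV v = w} =
          ⋃ u, {s | s.2.onV v = u} ∩ {s | s.1.onV u = w} := by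
        ext s; simp
      rw [this]
      exact isOpen_iUnion fun u => ((X.isOpen_onV v u).preimage continuous_snd).inter
        ((X.isOpen_onV u w).preimage continuous_fst)
    · intro v w
      have : {s : X.Aut × X.Aut | (s.1 * s.2).onE v = w} =
          ⋃ u, {s | s.2.onE v = u} ∩ {s | s.1.onE u = w} := by
        ext s; simp
      rw [this]
      exact isOpen_iUnion fun u => ((X.isOpen_onE v u).preimage continuous_snd).inter
        ((X.isOpen_onE u w).preimage continuous_fst)
  continuous_inv := by
    apply continuous_to_aut
    · intro v w
      have : {s : X.Aut | (s⁻¹).onV v = w} = {s | s.onV w = v} := by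
        ext s
        constructor
        · rintro rfl
          change (s * s⁻¹).onV v = v
          simp
        · rintro rfl
          change (s⁻¹ * s).onV w = w
          simp
      rw [this]
      exact X.isOpen_onV w v
    · intro v w
      have : {s : X.Aut | (s⁻¹).onE v = w} = {s | s.onE w = v} := by
        ext s
        constructor
        · rintro rfl
          change (s * s⁻¹).onE v = v
          simp
        · rintro rfl
          change (s⁻¹ * s).onE w = w
          simp
      rw [this]
      exact X.isOpen_onE w v

end OGraph

/-! ### Graphs of `ℤⁿ`'s and their Bass-Serre fundamental groups -/

/-- The group `ℤⁿ`, written multiplicatively. -/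
abbrev ZZ (n : ℕ) : Type := Multiplicative (Fin n → ℤ)

/-- The group `ℝⁿ`, written multiplicatively, with its usual topology. -/
abbrev RR (n : ℕ) : Type := Multiplicative (Fin n → ℝ)

/-- A graph of groups on a connected graph, with all vertex and edge groups equal to `ℤⁿ`; the
monomorphism from the group of the edge `e` to the group of the vertex `plus e` is given by an
integer matrix `σ e` with non-zero determinant. -/
structure ZnGraph (n : ℕ) (V : Type*) (E : Type*) extends OGraph V E where
  connected : toOGraph.IsConnected
  σ : E → Matrix (Fin n) (Fin n) ℤ
  det_ne_zero : ∀ e, (σ e).det ≠ 0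

namespace ZnGraph

open Matrix

variable {n : ℕ} {V E : Type*} (𝒢 : ZnGraph n V E)

/-- The monomorphism from the group of the edge `e` to the group of the vertex `plus e`. -/
def edgeHom (e : E) : ZZ n →* ZZ n :=
  AddMonoidHom.toMultiplicative (Matrix.mulVecLin (𝒢.σ e)).toAddMonoidHom

/-- The free product of the vertex groups and of the free group on the oriented edges. -/
abbrev Pre (n : ℕ) (V : Type*) (E : Type*) : Type _ :=
  Monoid.Coprod (Monoid.CoprodI (fun _ : V => ZZ n)) (FreeGroup E)

/-- The vertex groups inside the free product. -/
def preVert (v : V) : ZZ n →* Pre n V E :=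
  Monoid.Coprod.inl.comp (Monoid.CoprodI.of (M := fun _ : V => ZZ n) (i := v))

/-- The generators `t_e` inside the free product. -/
def preStable (e : E) : Pre n V E := Monoid.Coprod.inr (FreeGroup.of e)

variable (T : 𝒢.toOGraph.MaxTree)

/-- The defining relations `t_e σ_e(g) t_e⁻¹ = σ_{bar e}(g)` and `t_e t_{bar e} = 1` for all
edges, and `t_e = 1` for the edges of the maximal tree. -/
def rels : Set (Pre n V E) :=
  {r | ∃ (e : E) (g : ZZ n), r = preStable e * preVert (𝒢.plus e) (𝒢.edgeHom e g) *
      (preStable e)⁻¹ * (preVert (𝒢.minus e) (𝒢.edgeHom (𝒢.bar e) g))⁻¹} ∪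
  {r | ∃ e : E, r = preStable e * preStable (𝒢.bar e)} ∪
  {r | ∃ e ∈ T.edges, r = preStable e}

/-- The Bass-Serre fundamental group of the graph of groups, relative to the maximal tree `T`. -/
def FundGroup : Type _ := Pre n V E ⧸ Subgroup.normalClosure (𝒢.rels T)

instance : Group (𝒢.FundGroup T) :=
  inferInstanceAs (Group (Pre n V E ⧸ Subgroup.normalClosure (𝒢.rels T)))

/-- The fundamental group (and, by restriction, each of its subgroups) is a discrete group. -/
instance : TopologicalSpace (𝒢.FundGroup T) := ⊥

instance : DiscreteTopology (𝒢.FundGroup T) := ⟨rfl⟩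

/-- The quotient map. -/
def proj : Pre n V E →* 𝒢.FundGroup T := QuotientGroup.mk' (Subgroup.normalClosure (𝒢.rels T))

/-- The homomorphism from the vertex group at `v` to the fundamental group. -/
def vert (v : V) : ZZ n →* 𝒢.FundGroup T := (𝒢.proj T).comp (preVert v)

/-- The stable letter `t_e` in the fundamental group. -/
def stable (e : E) : 𝒢.FundGroup T := 𝒢.proj T (preStable e)

lemma proj_eq_one {r : Pre n V E} (h : r ∈ 𝒢.rels T) : 𝒢.proj T r = 1 :=
  (QuotientGroup.eq_one_iff r).2 (Subgroup.subset_normalClosure h)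

lemma stable_conj (e : E) (g : ZZ n) :
    𝒢.stable T e * 𝒢.vert T (𝒢.plus e) (𝒢.edgeHom e g) * (𝒢.stable T e)⁻¹ =
      𝒢.vert T (𝒢.minus e) (𝒢.edgeHom (𝒢.bar e) g) := by
  have h := 𝒢.proj_eq_one T (Or.inl (Or.inl ⟨e, g, rfl⟩))
  simp only [map_mul] at h
  exact mul_inv_eq_one.1 h

lemma stable_mul_bar (e : E) : 𝒢.stable T e * 𝒢.stable T (𝒢.bar e) = 1 := by
  have h := 𝒢.proj_eq_one T (Or.inl (Or.inr ⟨e, rfl⟩))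
  rwa [map_mul] at h

lemma stable_bar (e : E) : 𝒢.stable T (𝒢.bar e) = (𝒢.stable T e)⁻¹ :=
  (inv_eq_of_mul_eq_one_right (𝒢.stable_mul_bar T e)).symm

lemma stable_tree {e : E} (he : e ∈ T.edges) : 𝒢.stable T e = 1 :=
  𝒢.proj_eq_one T (Or.inr ⟨e, he, rfl⟩)

section lift

variable {K : Type*} [Group K] (f : V → ZZ n →* K) (s : E → K)

/-- A homomorphism out of the fundamental group, given by its values on the generators. -/
def lift
    (h1 : ∀ e g, s e * f (𝒢.plus e) (𝒢.edgeHom e g) * (s e)⁻¹ =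
      f (𝒢.minus e) (𝒢.edgeHom (𝒢.bar e) g))
    (h2 : ∀ e, s e * s (𝒢.bar e) = 1) (h3 : ∀ e ∈ T.edges, s e = 1) :
    𝒢.FundGroup T →* K :=
  QuotientGroup.lift (Subgroup.normalClosure (𝒢.rels T))
    (Monoid.Coprod.lift (Monoid.CoprodI.lift f) (FreeGroup.lift s)) (by
      refine Subgroup.normalClosure_le_normal ?_
      rintro r ((⟨e, g, rfl⟩ | ⟨e, rfl⟩) | ⟨e, he, rfl⟩)
      · change Monoid.Coprod.lift (Monoid.CoprodI.lift f) (FreeGroup.lift s) _ = 1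
        have hinv : ∀ x : Pre n V E, Monoid.Coprod.lift (Monoid.CoprodI.lift f)
            (FreeGroup.lift s) x⁻¹ = (Monoid.Coprod.lift (Monoid.CoprodI.lift f)
            (FreeGroup.lift s) x)⁻¹ := fun x => MonoidHom.map_inv _ x
        rw [map_mul, hinv, mul_inv_eq_one, map_mul, map_mul, hinv]
        simpa [preVert, preStable] using h1 e g
      · simpa [preVert, preStable, MonoidHom.mem_ker] using h2 e
      · simpa [preVert, preStable, MonoidHom.mem_ker] using h3 e he)

variable {f s}
variable (h1 : ∀ e g, s e * f (𝒢.plus e) (𝒢.edgeHom e g) * (s e)⁻¹ =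
      f (𝒢.minus e) (𝒢.edgeHom (𝒢.bar e) g))
    (h2 : ∀ e, s e * s (𝒢.bar e) = 1) (h3 : ∀ e ∈ T.edges, s e = 1)

@[simp] lemma lift_vert (v : V) (g : ZZ n) : 𝒢.lift T f s h1 h2 h3 (𝒢.vert T v g) = f v g := by
  change Monoid.Coprod.lift (Monoid.CoprodI.lift f) (FreeGroup.lift s) (preVert v g) = f v g
  simp [preVert]

@[simp] lemma lift_stable (e : E) : 𝒢.lift T f s h1 h2 h3 (𝒢.stable T e) = s e := by
  change Monoid.Coprod.lift (Monoid.CoprodI.lift f) (FreeGroup.lift s) (preStable e) = s e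
  simp [preStable]

end lift

lemma hom_ext {K : Type*} [Group K] {a b : 𝒢.FundGroup T →* K}
    (hv : ∀ v g, a (𝒢.vert T v g) = b (𝒢.vert T v g))
    (hs : ∀ e, a (𝒢.stable T e) = b (𝒢.stable T e)) : a = b := by
  refine QuotientGroup.monoidHom_ext _ (Monoid.Coprod.hom_ext ?_ ?_)
  · refine Monoid.CoprodI.ext_hom _ _ fun v => MonoidHom.ext fun g => hv v g
  · exact FreeGroup.ext_hom _ _ fun e => hs e

/-! ### The universal cover and the action on it -/

/-- The vertex group `G_v` as a subgroup of the fundamental group. -/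
def vertSub (v : V) : Subgroup (𝒢.FundGroup T) := (𝒢.vert T v).range

/-- The edge group `G_e` as a subgroup of the fundamental group: the image of the edge group in
the vertex group at `plus e`. -/
def edgeSub (e : E) : Subgroup (𝒢.FundGroup T) :=
  ((𝒢.vert T (𝒢.plus e)).comp (𝒢.edgeHom e)).range

/-- The vertices of the universal cover. -/
def CoverV : Type _ := Σ v : V, 𝒢.FundGroup T ⧸ 𝒢.vertSub T v

/-- The oriented edges of the universal cover. -/
def CoverE : Type _ := Σ e : E, 𝒢.FundGroup T ⧸ 𝒢.edgeSub T e

/-- The vertex `g G_v`. -/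
def mkV (v : V) (g : 𝒢.FundGroup T) : 𝒢.CoverV T := ⟨v, (g : 𝒢.FundGroup T ⧸ 𝒢.vertSub T v)⟩

/-- The edge `g G_e`. -/
def mkE (e : E) (g : 𝒢.FundGroup T) : 𝒢.CoverE T := ⟨e, (g : 𝒢.FundGroup T ⧸ 𝒢.edgeSub T e)⟩

lemma mkE_surj (x : 𝒢.CoverE T) : ∃ e g, x = 𝒢.mkE T e g := by
  obtain ⟨e, q⟩ := x
  obtain ⟨g, rfl⟩ := QuotientGroup.mk_surjective q
  exact ⟨e, g, rfl⟩

lemma mkV_surj (x : 𝒢.CoverV T) : ∃ v g, x = 𝒢.mkV T v g := by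
  obtain ⟨e, q⟩ := x
  obtain ⟨g, rfl⟩ := QuotientGroup.mk_surjective q
  exact ⟨e, g, rfl⟩

lemma edgeSub_le (e : E) : 𝒢.edgeSub T e ≤ 𝒢.vertSub T (𝒢.plus e) := by
  rintro _ ⟨g, rfl⟩
  exact ⟨_, rfl⟩

lemma stable_conj_mem {e : E} {h : 𝒢.FundGroup T} (hh : h ∈ 𝒢.edgeSub T e) :
    𝒢.stable T e * h * (𝒢.stable T e)⁻¹ ∈ 𝒢.edgeSub T (𝒢.bar e) := by
  obtain ⟨g, rfl⟩ := hh
  exact ⟨g, (𝒢.stable_conj T e g).symm⟩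

/-- The extremity map of the universal cover: `g G_e ↦ g G_{plus e}`. -/
def coverPlus (x : 𝒢.CoverE T) : 𝒢.CoverV T :=
  ⟨𝒢.plus x.1, Quotient.map' (s₁ := QuotientGroup.leftRel (𝒢.edgeSub T x.1))
    (s₂ := QuotientGroup.leftRel (𝒢.vertSub T (𝒢.plus x.1))) id (by
      intro a b hab
      rw [QuotientGroup.leftRel_apply] at hab ⊢
      exact 𝒢.edgeSub_le T _ hab) x.2⟩

/-- The involution of the universal cover: `g G_e ↦ g t_e⁻¹ G_{bar e}`, so that the origin of
`g G_e` is `g t_e⁻¹ G_{minus e}` (where `t_e = 1` if `e` lies in the maximal tree). -/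
def coverBar (x : 𝒢.CoverE T) : 𝒢.CoverE T :=
  ⟨𝒢.bar x.1, Quotient.map' (s₁ := QuotientGroup.leftRel (𝒢.edgeSub T x.1))
    (s₂ := QuotientGroup.leftRel (𝒢.edgeSub T (𝒢.bar x.1)))
    (fun g => g * (𝒢.stable T x.1)⁻¹) (by
      intro a b hab
      rw [QuotientGroup.leftRel_apply] at hab ⊢
      have h := 𝒢.stable_conj_mem T hab
      simpa [mul_assoc] using h) x.2⟩

lemma coverPlus_mk (e : E) (g : 𝒢.FundGroup T) :
    𝒢.coverPlus T (𝒢.mkE T e g) = 𝒢.mkV T (𝒢.plus e) g := rfl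

lemma coverBar_mk (e : E) (g : 𝒢.FundGroup T) :
    𝒢.coverBar T (𝒢.mkE T e g) = 𝒢.mkE T (𝒢.bar e) (g * (𝒢.stable T e)⁻¹) := rfl

/-- The universal cover (Bass-Serre tree) of the graph of groups. -/
def cover : OGraph (𝒢.CoverV T) (𝒢.CoverE T) where
  bar := 𝒢.coverBar T
  plus := 𝒢.coverPlus T
  bar_bar := by
    intro x
    obtain ⟨e, g, rfl⟩ := 𝒢.mkE_surj T x
    rw [coverBar_mk, coverBar_mk, stable_bar, 𝒢.bar_bar]
    simp
  bar_ne := by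
    intro x h
    exact 𝒢.bar_ne x.1 (congrArg Sigma.fst h)

/-- Left translation on the vertices of the universal cover. -/
def transV : 𝒢.FundGroup T →* Equiv.Perm (𝒢.CoverV T) where
  toFun g :=
    { toFun := fun x => ⟨x.1, g • x.2⟩
      invFun := fun x => ⟨x.1, g⁻¹ • x.2⟩
      left_inv := fun x => Sigma.ext rfl (heq_of_eq (inv_smul_smul _ _))
      right_inv := fun x => Sigma.ext rfl (heq_of_eq (smul_inv_smul _ _)) }
  map_one' := by ext x : 1; exact Sigma.ext rfl (heq_of_eq (one_smul _ _))
  map_mul' g h := by ext x : 1; exact Sigma.ext rfl (heq_of_eq (mul_smul _ _ _))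

/-- Left translation on the edges of the universal cover. -/
def transE : 𝒢.FundGroup T →* Equiv.Perm (𝒢.CoverE T) where
  toFun g :=
    { toFun := fun x => ⟨x.1, g • x.2⟩
      invFun := fun x => ⟨x.1, g⁻¹ • x.2⟩
      left_inv := fun x => Sigma.ext rfl (heq_of_eq (inv_smul_smul _ _))
      right_inv := fun x => Sigma.ext rfl (heq_of_eq (smul_inv_smul _ _)) }
  map_one' := by ext x : 1; exact Sigma.ext rfl (heq_of_eq (one_smul _ _))
  map_mul' g h := by ext x : 1; exact Sigma.ext rfl (heq_of_eq (mul_smul _ _ _))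

lemma transV_mk (g h : 𝒢.FundGroup T) (v : V) :
    𝒢.transV T g (𝒢.mkV T v h) = 𝒢.mkV T v (g * h) := rfl

lemma transE_mk (g h : 𝒢.FundGroup T) (e : E) :
    𝒢.transE T g (𝒢.mkE T e h) = 𝒢.mkE T e (g * h) := rfl

/-- The homomorphism from the fundamental group to the automorphism group of the universal
cover, given by left translation. -/
def ι : 𝒢.FundGroup T →* (𝒢.cover T).Aut :=
  ((𝒢.transV T).prod (𝒢.transE T)).codRestrict (𝒢.cover T).autSubgroup (by
    intro g x
    obtain ⟨e, h, rfl⟩ := 𝒢.mkE_surj T x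
    change 𝒢.coverPlus T (𝒢.transE T g _) = 𝒢.transV T g (𝒢.coverPlus T _) ∧
      𝒢.coverBar T (𝒢.transE T g _) = 𝒢.transE T g (𝒢.coverBar T _)
    simp only [transE_mk, coverPlus_mk, transV_mk, coverBar_mk, mul_assoc, and_self])

lemma ι_onV (g h : 𝒢.FundGroup T) (v : V) :
    (𝒢.ι T g).onV (𝒢.mkV T v h) = 𝒢.mkV T v (g * h) := rfl

/-- The closure of the image of the fundamental group in the automorphism group of the tree. -/
def closureι : Subgroup (𝒢.cover T).Aut := (𝒢.ι T).range.topologicalClosure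

/-! ### The group generated by the stable letters -/

variable (A : 𝒢.toOGraph.Orientation)

/-- The subgroup `H_d` generated by the stable letters `t_e`, where `e` runs over the edges of
the orientation which do not lie in the maximal tree. -/
def H : Subgroup (𝒢.FundGroup T) :=
  Subgroup.closure {x | ∃ e ∈ A.edges, e ∉ T.edges ∧ x = 𝒢.stable T e}

lemma stable_mem_H (e : E) : 𝒢.stable T e ∈ 𝒢.H T A := by
  by_cases hT : e ∈ T.edges
  · rw [𝒢.stable_tree T hT]; exact one_mem _
  · by_cases hA : e ∈ A.edges
    · exact Subgroup.subset_closure ⟨e, hA, hT, rfl⟩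
    · have hb : 𝒢.bar e ∈ A.edges := by
        by_contra hb
        exact hA ((A.mem_iff e).2 hb)
      have hbT : 𝒢.bar e ∉ T.edges := fun h => hT (by
        have := T.bar_mem _ h
        rwa [𝒢.bar_bar] at this)
      have : (𝒢.stable T e)⁻¹ ∈ 𝒢.H T A := by
        rw [← stable_bar]
        exact Subgroup.subset_closure ⟨_, hb, hbT, rfl⟩
      exact (Subgroup.inv_mem_iff _).1 this

/-- The epimorphism onto `H_d` which kills the vertex groups and fixes the stable letters. -/
def φ : 𝒢.FundGroup T →* 𝒢.H T A :=
  𝒢.lift T (fun _ => 1) (fun e => ⟨𝒢.stable T e, 𝒢.stable_mem_H T A e⟩)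
    (by intro e g; simp) (fun e => Subtype.ext (𝒢.stable_mul_bar T e))
    (fun _ he => Subtype.ext (𝒢.stable_tree T he))

@[simp] lemma φ_vert (v : V) (g : ZZ n) : 𝒢.φ T A (𝒢.vert T v g) = 1 := by simp [φ]

@[simp] lemma φ_stable (e : E) :
    𝒢.φ T A (𝒢.stable T e) = ⟨𝒢.stable T e, 𝒢.stable_mem_H T A e⟩ := by simp [φ]

/-- The map `g G_v ↦ φ g` on the vertices of the universal cover. -/
def label (x : 𝒢.CoverV T) : 𝒢.H T A :=
  Quotient.liftOn' (s₁ := QuotientGroup.leftRel (𝒢.vertSub T x.1)) x.2 (𝒢.φ T A) (by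
    intro a b hab
    rw [QuotientGroup.leftRel_apply] at hab
    obtain ⟨g, hg⟩ := hab
    have : 𝒢.φ T A (a⁻¹ * b) = 1 := by rw [← hg]; simp
    rw [map_mul, map_inv, inv_mul_eq_one] at this
    exact this)

lemma label_mk (v : V) (g : 𝒢.FundGroup T) : 𝒢.label T A (𝒢.mkV T v g) = 𝒢.φ T A g := rfl

lemma isClosed_label (x y : 𝒢.CoverV T) : IsClosed {g : (𝒢.cover T).Aut |
    𝒢.label T A (g.onV x) * (𝒢.label T A x)⁻¹ = 𝒢.label T A (g.onV y) * (𝒢.label T A y)⁻¹} := by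
  have hc : ∀ x : 𝒢.CoverV T,
      Continuous (fun g : (𝒢.cover T).Aut => 𝒢.label T A (g.onV x)) := by
    intro x
    refine continuous_discrete_rng.2 fun b => ?_
    have : (fun g : (𝒢.cover T).Aut => 𝒢.label T A (g.onV x)) ⁻¹' {b} =
        ⋃ w ∈ {w | 𝒢.label T A w = b}, {g | g.onV x = w} := by
      ext g; simp
    rw [this]
    exact isOpen_biUnion fun w _ => (𝒢.cover T).isOpen_onV x w
  exact isClosed_eq ((hc x).mul continuous_const) ((hc y).mul continuous_const)

lemma label_eq {g : (𝒢.cover T).Aut} (hg : g ∈ 𝒢.closureι T) (x y : 𝒢.CoverV T) :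
    𝒢.label T A (g.onV x) * (𝒢.label T A x)⁻¹ = 𝒢.label T A (g.onV y) * (𝒢.label T A y)⁻¹ := by
  refine closure_minimal ?_ (𝒢.isClosed_label T A x y) hg
  rintro _ ⟨h, rfl⟩
  obtain ⟨v, a, rfl⟩ := 𝒢.mkV_surj T x
  obtain ⟨w, b, rfl⟩ := 𝒢.mkV_surj T y
  simp only [Set.mem_ofPred_eq, ι_onV, label_mk, map_mul, mul_inv_cancel_right]

variable (v₀ : V)

/-- The continuous extension of `φ` to the closure of the image of the fundamental group (see
`φbar_ι` and `continuous_φbar`; it is unique, hence does not depend on `v₀`). -/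
def φbar : 𝒢.closureι T →* 𝒢.H T A where
  toFun g := 𝒢.label T A (g.1.onV (𝒢.mkV T v₀ 1)) * (𝒢.label T A (𝒢.mkV T v₀ 1))⁻¹
  map_one' := by simp
  map_mul' g h := by
    rw [𝒢.label_eq T A g.2 (𝒢.mkV T v₀ 1) (h.1.onV (𝒢.mkV T v₀ 1))]
    simp

lemma φbar_ι (g : 𝒢.FundGroup T) (hg : 𝒢.ι T g ∈ 𝒢.closureι T) :
    𝒢.φbar T A v₀ ⟨𝒢.ι T g, hg⟩ = 𝒢.φ T A g := by
  change 𝒢.label T A ((𝒢.ι T g).onV (𝒢.mkV T v₀ 1)) * (𝒢.label T A (𝒢.mkV T v₀ 1))⁻¹ = _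
  simp [ι_onV, label_mk]

lemma continuous_φbar : Continuous (𝒢.φbar T A v₀) := by
  refine continuous_discrete_rng.2 fun b => ?_
  have : (𝒢.φbar T A v₀) ⁻¹' {b} = Subtype.val ⁻¹' (⋃ w ∈ {w | 𝒢.label T A w *
      (𝒢.label T A (𝒢.mkV T v₀ 1))⁻¹ = b}, {g | g.onV (𝒢.mkV T v₀ 1) = w}) := by
    ext g; simp [φbar]
  rw [this]
  exact (isOpen_biUnion fun w _ => (𝒢.cover T).isOpen_onV _ w).preimage continuous_subtype_val

/-! ### The homomorphisms to `ℝⁿ ⋊ GL_n(ℝ)` and `ℝⁿ ⋊ H_d` -/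

/-- The linear action of `GL_n(ℝ)` on `ℝⁿ`. -/
def glAct (n : ℕ) : GL (Fin n) ℝ →* MulAut (RR n) where
  toFun M := AddEquiv.toMultiplicative
    { toFun := fun x => (M : Matrix (Fin n) (Fin n) ℝ) *ᵥ x
      invFun := fun x => ((M⁻¹ : GL (Fin n) ℝ) : Matrix (Fin n) (Fin n) ℝ) *ᵥ x
      left_inv := fun x => by simp [Matrix.mulVec_mulVec]
      right_inv := fun x => by simp [Matrix.mulVec_mulVec]
      map_add' := fun x y => Matrix.mulVec_add _ _ _ }
  map_one' := by
    ext x : 1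
    change Multiplicative.ofAdd ((1 : Matrix (Fin n) (Fin n) ℝ) *ᵥ x.toAdd) = x
    simp
  map_mul' M N := by
    ext x : 1
    change Multiplicative.ofAdd (((M : Matrix (Fin n) (Fin n) ℝ) * (N : Matrix (Fin n) (Fin n) ℝ)) *ᵥ x.toAdd) =
      Multiplicative.ofAdd ((M : Matrix (Fin n) (Fin n) ℝ) *ᵥ
        ((N : Matrix (Fin n) (Fin n) ℝ) *ᵥ x.toAdd))
    simp [Matrix.mulVec_mulVec]

lemma glAct_apply (M : GL (Fin n) ℝ) (x : RR n) :
    glAct n M x = Multiplicative.ofAdd ((M : Matrix (Fin n) (Fin n) ℝ) *ᵥ x.toAdd) := rfl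

/-- The product topology on a semidirect product. -/
instance instTopSemidirect {N K : Type*} [Group N] [Group K] [TopologicalSpace N]
    [TopologicalSpace K] (θ : K →* MulAut N) : TopologicalSpace (N ⋊[θ] K) :=
  TopologicalSpace.induced (fun x => (x.left, x.right)) inferInstance

/-- The matrix `σ_e` as a real invertible matrix. -/
def sig (e : E) : GL (Fin n) ℝ :=
  Matrix.GeneralLinearGroup.mkOfDetNeZero ((𝒢.σ e).map (Int.cast : ℤ → ℝ)) (by
    have h : ((𝒢.σ e).map (Int.cast : ℤ → ℝ)).det = ((𝒢.σ e).det : ℝ) :=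
      ((Int.castRingHom ℝ).map_det (𝒢.σ e)).symm
    rw [h]
    exact_mod_cast 𝒢.det_ne_zero e)

/-- The path without backtracking from `v` to `w` in the maximal tree. -/
def treePath (v w : V) : List E := (T.existsUnique_path v w).choose

lemma treePath_spec (v w : V) : 𝒢.IsWalk v (𝒢.treePath T v w) w ∧
    𝒢.IsReduced (𝒢.treePath T v w) ∧ ∀ e ∈ 𝒢.treePath T v w, e ∈ T.edges :=
  (T.existsUnique_path v w).choose_spec.1

lemma eq_treePath {v w : V} {p : List E} (h1 : 𝒢.IsWalk v p w) (h2 : 𝒢.IsReduced p)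
    (h3 : ∀ e ∈ p, e ∈ T.edges) : p = 𝒢.treePath T v w :=
  (T.existsUnique_path v w).choose_spec.2 p ⟨h1, h2, h3⟩

/-- The ordered product, along a path, of the matrices `σ_{bar e} σ_e⁻¹`. An edge of a fixed
orientation which is travelled backwards thus contributes the inverse of `σ_{bar e} σ_e⁻¹`. -/
def pathMat (p : List E) : GL (Fin n) ℝ :=
  (p.map fun e => 𝒢.sig (𝒢.bar e) * (𝒢.sig e)⁻¹).prod

/-- The matrix `τ_v`: the ordered product along the path from `v₀` to `v` in the tree. -/
def τ (v : V) : GL (Fin n) ℝ := 𝒢.pathMat (𝒢.treePath T v₀ v)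

lemma τ_tree {e : E} (he : e ∈ T.edges) :
    𝒢.τ T v₀ (𝒢.minus e) * 𝒢.sig (𝒢.bar e) = 𝒢.τ T v₀ (𝒢.plus e) * 𝒢.sig e := by
  obtain ⟨h1, h2, h3⟩ := 𝒢.treePath_spec T v₀ (𝒢.minus e)
  by_cases hlast : ∃ q, 𝒢.treePath T v₀ (𝒢.minus e) = q ++ [𝒢.bar e]
  · obtain ⟨q, hq⟩ := hlast
    have hq' : q = 𝒢.treePath T v₀ (𝒢.plus e) := by
      rw [hq] at h1 h2 h3
      refine 𝒢.eq_treePath T ?_ (List.IsChain.left_of_append h2)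
        (fun f hf => h3 f (List.mem_append_left _ hf))
      have := (𝒢.isWalk_concat h1).1
      simpa [OGraph.minus, 𝒢.bar_bar] using this
    simp only [τ]
    rw [hq, ← hq']
    simp [pathMat, 𝒢.bar_bar, mul_assoc]
  · have hq : 𝒢.treePath T v₀ (𝒢.minus e) ++ [e] = 𝒢.treePath T v₀ (𝒢.plus e) := by
      refine 𝒢.eq_treePath T (𝒢.isWalk_append h1 ⟨rfl, rfl⟩) ?_ ?_
      · refine List.isChain_append.2 ⟨h2, List.isChain_singleton _, ?_⟩
        intro x hx y hy hxy
        simp only [List.head?_cons, Option.mem_def, Option.some.injEq] at hy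
        subst hy
        apply hlast
        obtain ⟨q, hq⟩ := List.mem_getLast?_eq_getLast hx
        refine ⟨(𝒢.treePath T v₀ (𝒢.minus e)).dropLast, ?_⟩
        have hbx : 𝒢.bar e = x := by rw [hxy, 𝒢.bar_bar]
        rw [hbx, hq, List.dropLast_append_getLast]
      · intro f hf
        rcases List.mem_append.1 hf with hf | hf
        · exact h3 f hf
        · rw [List.mem_singleton.1 hf]; exact he
    simp only [τ]
    rw [← hq]
    simp [pathMat, mul_assoc]

/-- The restriction of `μ` to the vertex group at `v`, with values in `ℝⁿ`: the map `τ_v`. -/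
def vertVec (v : V) : ZZ n →* RR n where
  toFun g := Multiplicative.ofAdd ((𝒢.τ T v₀ v : Matrix (Fin n) (Fin n) ℝ) *ᵥ
    fun i => ((g.toAdd i : ℤ) : ℝ))
  map_one' := by
    rw [← ofAdd_zero]
    congr 1
    ext i
    simp [Matrix.mulVec, dotProduct]
  map_mul' g h := by
    rw [← ofAdd_add, ← Matrix.mulVec_add]
    congr 2
    ext i
    simp

/-- The matrix `τ_{e₋} σ_{bar e} σ_e⁻¹ τ_{e₊}⁻¹`; it is trivial for the edges of the tree. -/
def stableMat (e : E) : GL (Fin n) ℝ :=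
  𝒢.τ T v₀ (𝒢.minus e) * 𝒢.sig (𝒢.bar e) * (𝒢.sig e)⁻¹ * (𝒢.τ T v₀ (𝒢.plus e))⁻¹

lemma vertVec_edgeHom (v : V) (e : E) (g : ZZ n) :
    𝒢.vertVec T v₀ v (𝒢.edgeHom e g) =
      glAct n (𝒢.τ T v₀ v * 𝒢.sig e) (Multiplicative.ofAdd fun i => ((g.toAdd i : ℤ) : ℝ)) := by
  rw [map_mul]
  change Multiplicative.ofAdd ((𝒢.τ T v₀ v : Matrix (Fin n) (Fin n) ℝ) *ᵥ _) =
    Multiplicative.ofAdd ((𝒢.τ T v₀ v : Matrix (Fin n) (Fin n) ℝ) *ᵥ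
      ((𝒢.sig e : Matrix (Fin n) (Fin n) ℝ) *ᵥ _))
  congr 2
  ext i
  simp [edgeHom, sig, Matrix.mulVec, dotProduct, Matrix.GeneralLinearGroup.mkOfDetNeZero]

/-- The homomorphism `μ` from the fundamental group to the affine group: `τ_v` on the vertex
group at `v`, and `stableMat e` on the stable letter `t_e`. -/
def μ : 𝒢.FundGroup T →* RR n ⋊[glAct n] GL (Fin n) ℝ :=
  𝒢.lift T (fun v => SemidirectProduct.inl.comp (𝒢.vertVec T v₀ v))
    (fun e => SemidirectProduct.inr (𝒢.stableMat T v₀ e))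
    (by
      intro e g
      rw [← map_inv]
      simp only [MonoidHom.comp_apply]
      rw [← SemidirectProduct.inl_aut]
      congr 1
      rw [vertVec_edgeHom, vertVec_edgeHom, ← MulAut.mul_apply, ← map_mul]
      congr 2
      simp [stableMat, mul_assoc])
    (by
      intro e
      rw [← map_mul]
      simp [stableMat, OGraph.minus, 𝒢.bar_bar, mul_assoc])
    (by
      intro e he
      have : 𝒢.stableMat T v₀ e = 1 := by
        rw [stableMat, τ_tree 𝒢 T v₀ he]
        simp
      simp [this])

/-- The linear action of `H_d` on `ℝⁿ` through `μ`. -/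
def linH : 𝒢.H T A →* GL (Fin n) ℝ :=
  SemidirectProduct.rightHom.comp ((𝒢.μ T v₀).comp (𝒢.H T A).subtype)

/-- The semidirect product `ℝⁿ ⋊_μ H_d`, where `H_d` is discrete. -/
abbrev SemiH : Type _ := RR n ⋊[(glAct n).comp (𝒢.linH T A v₀)] 𝒢.H T A

lemma linH_φ (g : 𝒢.FundGroup T) : 𝒢.linH T A v₀ (𝒢.φ T A g) = (𝒢.μ T v₀ g).right := by
  have h : (𝒢.linH T A v₀).comp (𝒢.φ T A) = SemidirectProduct.rightHom.comp (𝒢.μ T v₀) := by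
    refine 𝒢.hom_ext T ?_ ?_
    · intro v g
      simp [μ]
    · intro e
      simp [linH]
  exact DFunLike.congr_fun h g

/-- The homomorphism `ν` to `ℝⁿ ⋊_μ H_d` through which `μ` factors. -/
def ν : 𝒢.FundGroup T →* 𝒢.SemiH T A v₀ where
  toFun g := ⟨(𝒢.μ T v₀ g).left, 𝒢.φ T A g⟩
  map_one' := by ext <;> simp
  map_mul' g h := by
    refine SemidirectProduct.ext ?_ ?_
    · simp [linH_φ]
    · simp

/-! ### The fiber product and cocompact lattices -/

/-- The fiber product `W` of `φbar : closureι → H_d` and of the projection `ℝⁿ ⋊_μ H_d → H_d`,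
as a subgroup of `Aut × (ℝⁿ ⋊_μ H_d)`. -/
def W : Subgroup ((𝒢.cover T).Aut × 𝒢.SemiH T A v₀) where
  carrier := {p | ∃ hp : p.1 ∈ 𝒢.closureι T, 𝒢.φbar T A v₀ ⟨p.1, hp⟩ = p.2.right}
  one_mem' := ⟨one_mem _, map_one (𝒢.φbar T A v₀)⟩
  mul_mem' := by
    rintro a b ⟨ha, ha'⟩ ⟨hb, hb'⟩
    refine ⟨mul_mem ha hb, ?_⟩
    rw [Prod.snd_mul, SemidirectProduct.mul_right, ← ha', ← hb', ← map_mul]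
    rfl
  inv_mem' := by
    rintro a ⟨ha, ha'⟩
    refine ⟨inv_mem ha, ?_⟩
    rw [Prod.snd_inv, SemidirectProduct.inv_right, ← ha', ← map_inv]
    rfl

end ZnGraph

/-- A subgroup `Γ` of a topological group `W` is a cocompact lattice if it is discrete and the
quotient `W ⧸ Γ` is compact. -/
def IsCocompactLattice {W : Type*} [Group W] [TopologicalSpace W] (Γ : Subgroup W) : Prop :=
  DiscreteTopology Γ ∧ CompactSpace (W ⧸ Γ)

end GraphZn

end

open Topology

noncomputable section

namespace GraphZn

/-! ### Convergence and compactness in the automorphism group of a graph -/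

namespace OGraph

variable {V E : Type*} (X : OGraph V E)

/-! Since `τ v₀ = 1`, the base vertex group acts on `ℝⁿ` by integer translations. Elements of `G`
with the same effect on the base vertex of the tree differ on the right by some `a` in that group
(`onV_mkV_eq_iff`), and undoing the affine map `μ γ` reads `a` off the translation part of `μ (γ a)`
(`recover_μ`). As `0` is the only integer vector in the open unit box, the image of the base vertex
together with the translation part isolates `γ`: this gives injectivity and discreteness
(`eq_of_mem`). Properness follows in the same way, since a compact set allows finitely many images
of the base vertex and, for each of them, finitely many integer vectors.

For cocompactness, the stabilizer of the base vertex in the closure is compact (`isCompact_stab`):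
all conjugates of all vertex groups are commensurable, because the matrices have non-zero
determinant, so orbits are finite. By density, right multiplication by `G` brings any element of `W`
over this stabilizer. The fiber product condition then makes its second component a pure
translation, which the base vertex group moves into the unit cube without disturbing the base
vertex. -/

lemma tendsto_nhds_aut {S : Type*} {l : Filter S} {f : S → X.Aut} {g : X.Aut}
    (hV : ∀ v, ∀ᶠ s in l, (f s).onV v = g.onV v) (hE : ∀ e, ∀ᶠ s in l, (f s).onE e = g.onE e) :
    Filter.Tendsto f l (𝓝 g) := by
  have h := nhds_inf (a := g)
    (t₁ := ⨅ v : V, TopologicalSpace.induced (fun g : X.Aut => g.onV v) ⊥)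
    (t₂ := ⨅ e : E, TopologicalSpace.induced (fun g : X.Aut => g.onE e) ⊥)
  refine le_of_le_of_eq ?_ h.symm
  rw [nhds_iInf, nhds_iInf]
  change Filter.Tendsto f l _
  simp only [nhds_induced, Filter.tendsto_inf, Filter.tendsto_iInf, Filter.tendsto_comap_iff]
  refine ⟨fun v => ?_, fun e => ?_⟩
  · let _ : TopologicalSpace V := ⊥
    have _ : DiscreteTopology V := ⟨rfl⟩
    exact tendsto_nhds_of_eventually_eq (hV v)
  · let _ : TopologicalSpace E := ⊥
    have _ : DiscreteTopology E := ⟨rfl⟩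
    exact tendsto_nhds_of_eventually_eq (hE e)

/-- The eventual value of a family of permutations along a filter, if the family is eventually
constant at every point, together with its inverses. -/
lemma exists_perm_of_eventually {S α : Type*} {F : Filter S} [F.NeBot] {f : S → Equiv.Perm α}
    (h : ∀ a, ∃ b, ∀ᶠ s in F, f s a = b) (h' : ∀ a, ∃ b, ∀ᶠ s in F, (f s)⁻¹ a = b) :
    ∃ p : Equiv.Perm α, ∀ a, ∀ᶠ s in F, f s a = p a := by
  choose p hp using h
  choose q hq using h'
  refine ⟨⟨p, q, fun a => ?_, fun a => ?_⟩, hp⟩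
  -- As `F` is non-trivial, a single `s` attains both limit values, and there the two maps are
  -- inverse to each other.
  · obtain ⟨s, h1, h2⟩ := ((hp a).and (hq (p a))).exists
    rw [← h2, ← h1, Equiv.Perm.coe_inv, Equiv.symm_apply_apply]
  · obtain ⟨s, h1, h2⟩ := ((hq a).and (hp (q a))).exists
    rw [← h2, ← h1, Equiv.Perm.coe_inv, Equiv.apply_symm_apply]

/-- An ultrafilter concentrates on one piece of a finite partition. -/
lemma eventually_const_of_finite {S α : Type*} {F : Ultrafilter S} {K : Set S} {o : S → α}
    (hF : ∀ᶠ s in (F : Filter S), s ∈ K) (ho : {a | ∃ s ∈ K, o s = a}.Finite) :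
    ∃ a, ∀ᶠ s in (F : Filter S), o s = a := by
  obtain ⟨a, -, ha⟩ := (Ultrafilter.eventually_exists_mem_iff (f := F)
    (P := fun a s => o s = a) ho).1 (hF.mono fun s hs => ⟨o s, ⟨s, hs, rfl⟩, rfl⟩)
  exact ⟨a, ha⟩

/-- A closed subgroup of the automorphism group with finite orbits is compact. -/
lemma isCompact_of_finite_orbits {K : Subgroup X.Aut} (hK : IsClosed (K : Set X.Aut))
    (hV : ∀ v, {w | ∃ g ∈ K, g.onV v = w}.Finite) (hE : ∀ e, {f | ∃ g ∈ K, g.onE e = f}.Finite) :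
    IsCompact (K : Set X.Aut) := by
  rw [isCompact_iff_ultrafilter_le_nhds]
  intro F hF
  have hF' : ∀ᶠ g in (F : Filter X.Aut), g ∈ K := Filter.le_principal_iff.1 hF
  obtain ⟨p, hp⟩ := exists_perm_of_eventually (F := (F : Filter X.Aut))
    (f := fun g : X.Aut => g.onV) (fun v => eventually_const_of_finite hF' (hV v))
    (fun v => eventually_const_of_finite hF' ((hV v).subset (by rintro _ ⟨g, hg, rfl⟩; exact ⟨g⁻¹, inv_mem hg, rfl⟩)))
  obtain ⟨q, hq⟩ := exists_perm_of_eventually (F := (F : Filter X.Aut))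
    (f := fun g : X.Aut => g.onE) (fun v => eventually_const_of_finite hF' (hE v))
    (fun v => eventually_const_of_finite hF' ((hE v).subset (by rintro _ ⟨g, hg, rfl⟩; exact ⟨g⁻¹, inv_mem hg, rfl⟩)))
  have haut : (p, q) ∈ X.autSubgroup := by
    intro e
    -- Compatibility at `e` involves only three values of the limit, and some automorphism `g` takes
    -- all three.
    obtain ⟨g, ⟨h1, h2⟩, h3⟩ := (((hq e).and (hp (X.plus e))).and (hq (X.bar e))).exists
    obtain ⟨h4, h5⟩ := g.2 e
    exact ⟨by rw [← h1, ← h2]; exact h4, by rw [← h1, ← h3]; exact h5⟩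
  let g₀ : X.Aut := ⟨(p, q), haut⟩
  have hlim : (F : Filter X.Aut) ≤ 𝓝 g₀ := X.tendsto_nhds_aut (f := id) hp hq
  exact ⟨g₀, hK.mem_of_tendsto hlim hF', hlim⟩

/-- A compact set of automorphisms moves a vertex to finitely many vertices only. -/
lemma finite_onV_image {K : Set X.Aut} (hK : IsCompact K) (v : V) :
    ((fun g : X.Aut => g.onV v) '' K).Finite := by
  let _ : TopologicalSpace V := ⊥
  have _ : DiscreteTopology V := ⟨rfl⟩
  exact (hK.image (continuous_discrete_rng.2 fun w => X.isOpen_onV v w)).finite_of_discrete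

end OGraph

open scoped Pointwise in
/-- If `L` has a conjugate `gLg⁻¹` meeting `K` in a subgroup of finite index of `K`, then the
`K`-orbit of the coset `gL` is finite. -/
lemma finite_orbit_of_relIndex {G : Type*} [Group G] {K L : Subgroup G} (g : G)
    (h : (ConjAct.toConjAct g • L).relIndex K ≠ 0) :
    {x : G ⧸ L | ∃ a ∈ K, x = ((a * g : G) : G ⧸ L)}.Finite := by
  have _ : Finite (K ⧸ (ConjAct.toConjAct g • L).subgroupOf K) :=
    Subgroup.index_ne_zero_iff_finite.1 h
  -- Representatives of `K` modulo `K ∩ gLg⁻¹` reach the whole orbit, since `akgL = agL` for `k ∈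
  -- gLg⁻¹`.
  refine (Set.finite_range fun q : K ⧸ (ConjAct.toConjAct g • L).subgroupOf K =>
    (((q.out : G) * g : G) : G ⧸ L)).subset ?_
  rintro _ ⟨a, ha, rfl⟩
  refine ⟨((⟨a, ha⟩ : K) : K ⧸ (ConjAct.toConjAct g • L).subgroupOf K), ?_⟩
  obtain ⟨k, hk⟩ := QuotientGroup.mk_out_eq_mul ((ConjAct.toConjAct g • L).subgroupOf K)
    (⟨a, ha⟩ : K)
  simp only [hk]
  have hk' := k.2
  rw [Subgroup.mem_subgroupOf, Subgroup.mem_pointwise_smul_iff_inv_smul_mem,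
    ← ConjAct.toConjAct_inv, ConjAct.toConjAct_smul] at hk'
  rw [eq_comm, QuotientGroup.eq]
  simpa [mul_assoc] using hk'

namespace ZnGraph

open Matrix
open scoped Pointwise

variable {n : ℕ} {V E : Type*} (𝒢 : ZnGraph n V E) (T : 𝒢.toOGraph.MaxTree)

/-! ### Commensurability of the vertex groups -/

/-- The image of an injective integer matrix has index equal to the absolute value of its
determinant. -/
lemma index_range_edgeHom (e : E) : (𝒢.edgeHom e).range.index ≠ 0 := by
  have hinj : Function.Injective (Matrix.mulVecLin (𝒢.σ e)) :=
    Matrix.mulVec_injective_of_det_ne_zero (𝒢.det_ne_zero e)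
  have h := Submodule.natAbs_det_equiv (LinearMap.range (Matrix.mulVecLin (𝒢.σ e)))
    (LinearEquiv.ofInjective _ hinj)
  have h2 : (LinearMap.range (Matrix.mulVecLin (𝒢.σ e))).subtype ∘ₗ AddMonoidHom.toIntLinearMap
      (LinearEquiv.ofInjective _ hinj : (Fin n → ℤ) →+ LinearMap.range (Matrix.mulVecLin (𝒢.σ e)))
      = Matrix.toLin' (𝒢.σ e) := rfl
  rw [h2, LinearMap.det_toLin'] at h
  change Nat.card ((Fin n → ℤ) ⧸ LinearMap.range (Matrix.mulVecLin (𝒢.σ e))) ≠ 0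
  rw [← h]
  exact Int.natAbs_ne_zero.2 (𝒢.det_ne_zero e)

lemma commensurable_edgeSub (e : E) :
    (𝒢.edgeSub T e).Commensurable (𝒢.vertSub T (𝒢.plus e)) := by
  constructor
  -- Injectivity of `vert` is not needed: enlarging the range of `edgeHom e` by the kernel only
  -- replaces the index by a divisor.
  · rw [edgeSub, vertSub, MonoidHom.range_comp, MonoidHom.range_eq_map (𝒢.vert T _),
      Subgroup.relIndex_map_map, top_sup_eq, Subgroup.relIndex_top_right]
    exact ne_zero_of_dvd_ne_zero (𝒢.index_range_edgeHom e) (Subgroup.index_dvd_of_le le_sup_left)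
  · rw [Subgroup.relIndex_eq_one.2 (𝒢.edgeSub_le T e)]
    exact one_ne_zero

lemma conj_edgeSub (e : E) :
    ConjAct.toConjAct (𝒢.stable T e) • 𝒢.edgeSub T e = 𝒢.edgeSub T (𝒢.bar e) := by
  ext x
  rw [Subgroup.mem_pointwise_smul_iff_inv_smul_mem, ← ConjAct.toConjAct_inv,
    ConjAct.toConjAct_smul]
  constructor
  · intro h
    simpa [mul_assoc] using 𝒢.stable_conj_mem T h
  · intro h
    have := 𝒢.stable_conj_mem T h
    rwa [𝒢.bar_bar, stable_bar] at this

/-- Both groups contain `t_e G_e t_e⁻¹ = G_{bar e}` with finite index. -/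
lemma commensurable_stable (e : E) :
    (ConjAct.toConjAct (𝒢.stable T e) • 𝒢.vertSub T (𝒢.plus e)).Commensurable
      (𝒢.vertSub T (𝒢.minus e)) := by
  have h := (𝒢.commensurable_edgeSub T e).conj (ConjAct.toConjAct (𝒢.stable T e))
  rw [conj_edgeSub] at h
  exact h.symm.trans (𝒢.commensurable_edgeSub T (𝒢.bar e))

/-- Stable letters of tree edges are trivial, so `commensurable_stable` can be chained along the
path in the tree. -/
lemma commensurable_vertSub (v w : V) :
    (𝒢.vertSub T v).Commensurable (𝒢.vertSub T w) := by
  obtain ⟨h1, -, h3⟩ := 𝒢.treePath_spec T v w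
  revert h1 h3
  generalize 𝒢.treePath T v w = p
  intro h1 h3
  induction p generalizing v with
  | nil => cases h1; exact .refl _
  | cons e p ih =>
    obtain ⟨rfl, h1⟩ := h1
    have h := 𝒢.commensurable_stable T e
    rw [𝒢.stable_tree T (h3 e List.mem_cons_self), ConjAct.toConjAct_one, one_smul] at h
    exact h.symm.trans (ih _ h1 fun f hf => h3 f (List.mem_cons_of_mem _ hf))

/-- A subgroup which contains the vertex groups and the stable letters is the whole group. -/
lemma mem_of_generators (K : Subgroup (𝒢.FundGroup T)) (hv : ∀ v g, 𝒢.vert T v g ∈ K)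
    (hs : ∀ e, 𝒢.stable T e ∈ K) (x : 𝒢.FundGroup T) : x ∈ K := by
  let f : 𝒢.FundGroup T →* K :=
    𝒢.lift T (fun v => (𝒢.vert T v).codRestrict K (hv v)) (fun e => ⟨𝒢.stable T e, hs e⟩)
      (fun e g => Subtype.ext (𝒢.stable_conj T e g)) (fun e => Subtype.ext (𝒢.stable_mul_bar T e))
      (fun e he => Subtype.ext (𝒢.stable_tree T he))
  have hf : K.subtype.comp f = MonoidHom.id _ :=
    𝒢.hom_ext T (by intro v g; simp [f]) (by intro e; simp [f])
  have := DFunLike.congr_fun hf x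
  rw [← MonoidHom.id_apply _ x, ← this]
  exact (f x).2

/-- The commensurator of a vertex group is a subgroup containing all generators, hence everything.
-/
lemma commensurable_conj_vertSub (v w : V) (g : 𝒢.FundGroup T) :
    (ConjAct.toConjAct g • 𝒢.vertSub T v).Commensurable (𝒢.vertSub T w) := by
  refine .trans ?_ (𝒢.commensurable_vertSub T v w)
  change g ∈ Subgroup.Commensurable.commensurator (𝒢.vertSub T v)
  refine 𝒢.mem_of_generators T _ (fun u a => ?_) (fun e => ?_) g
  -- Commensurable groups have the same commensurator; passing from `G_v` to `G_u` makes conjugation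
  -- by an element of `G_u` harmless.
  · rw [← (𝒢.commensurable_vertSub T u v).eq, Subgroup.Commensurable.commensurator_mem_iff]
    change (MulAut.conj (𝒢.vert T u a) • 𝒢.vertSub T u).Commensurable _
    rw [Subgroup.conj_smul_eq_self_of_mem (show 𝒢.vert T u a ∈ 𝒢.vertSub T u from ⟨a, rfl⟩)]
  · rw [Subgroup.Commensurable.commensurator_mem_iff]
    exact ((𝒢.commensurable_vertSub T v _).conj _).trans
      ((𝒢.commensurable_stable T e).trans (𝒢.commensurable_vertSub T _ v))

/-! ### The stabilizer of a vertex in the closure -/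

/-- The stabilizer of the vertex `G_v` in the fundamental group is `G_v` itself. -/
lemma onV_mkV_eq_iff {v : V} {g h : 𝒢.FundGroup T} :
    (𝒢.ι T g).onV (𝒢.mkV T v 1) = (𝒢.ι T h).onV (𝒢.mkV T v 1) ↔ ∃ a, g = h * 𝒢.vert T v a := by
  rw [ι_onV, ι_onV, mul_one, mul_one, eq_comm]
  refine Iff.trans (b := (h : 𝒢.FundGroup T ⧸ 𝒢.vertSub T v) = g)
    (Sigma.mk.inj_iff.trans (by simp)) ?_
  rw [QuotientGroup.eq]
  constructor
  · rintro ⟨a, ha⟩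
    exact ⟨a, by rw [ha, mul_inv_cancel_left]⟩
  · rintro ⟨a, rfl⟩
    exact ⟨a, by rw [inv_mul_cancel_left]⟩

/-- The stabilizer of the vertex `G_v` of the universal cover in the closure of the fundamental
group. -/
def stab (v : V) : Subgroup (𝒢.cover T).Aut where
  carrier := {g | g ∈ 𝒢.closureι T ∧ g.onV (𝒢.mkV T v 1) = 𝒢.mkV T v 1}
  one_mem' := ⟨one_mem _, rfl⟩
  mul_mem' := fun ha hb => ⟨mul_mem ha.1 hb.1, by
    rw [OGraph.Aut.onV_mul, hb.2, ha.2]⟩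
  inv_mem' := fun {a} ha => ⟨inv_mem ha.1, by
    conv_lhs => rw [← ha.2]
    rw [← OGraph.Aut.onV_mul, inv_mul_cancel, OGraph.Aut.onV_one]⟩

lemma isClosed_stab (v : V) : IsClosed (𝒢.stab T v : Set (𝒢.cover T).Aut) := by
  refine (Subgroup.isClosed_topologicalClosure _).inter (isOpen_compl_iff.1 ?_)
  have : {g : (𝒢.cover T).Aut | g.onV (𝒢.mkV T v 1) = 𝒢.mkV T v 1}ᶜ =
      ⋃ w ∈ {w | w ≠ 𝒢.mkV T v 1}, {g | g.onV (𝒢.mkV T v 1) = w} := by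
    ext g; simp
  change IsOpen {g : (𝒢.cover T).Aut | g.onV (𝒢.mkV T v 1) = 𝒢.mkV T v 1}ᶜ
  rw [this]
  exact isOpen_biUnion fun w _ => (𝒢.cover T).isOpen_onV _ w

lemma exists_ι_mem {U : Set (𝒢.cover T).Aut} (hU : IsOpen U) {g : (𝒢.cover T).Aut}
    (hg : g ∈ 𝒢.closureι T) (hgU : g ∈ U) : ∃ γ, 𝒢.ι T γ ∈ U := by
  obtain ⟨_, h, γ, rfl⟩ := mem_closure_iff.1 hg U hU hgU
  exact ⟨γ, h⟩

/-- On an open set, the stabilizer of `G_v` in the closure is approximated by `G_v`. -/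
lemma exists_vert_mem {U : Set (𝒢.cover T).Aut} (hU : IsOpen U) {v : V} {g : (𝒢.cover T).Aut}
    (hg : g ∈ 𝒢.stab T v) (hgU : g ∈ U) : ∃ a, 𝒢.ι T (𝒢.vert T v a) ∈ U := by
  -- Shrinking `U` to automorphisms fixing the vertex forces the approximating element into `G_v`.
  obtain ⟨γ, h1, h2⟩ := 𝒢.exists_ι_mem T
    (hU.inter ((𝒢.cover T).isOpen_onV (𝒢.mkV T v 1) (𝒢.mkV T v 1))) hg.1 ⟨hgU, hg.2⟩
  obtain ⟨a, ha⟩ := (𝒢.onV_mkV_eq_iff T (g := γ) (h := 1)).1 (by rw [map_one]; exact h2)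
  exact ⟨a, by rwa [ha, one_mul] at h1⟩

/-- By density the orbits of the stabilizer are already orbits of `G_v`, and these are finite
because `G_v` is commensurable with every conjugate of a vertex or edge group. -/
lemma isCompact_stab (v : V) : IsCompact (𝒢.stab T v : Set (𝒢.cover T).Aut) := by
  refine (𝒢.cover T).isCompact_of_finite_orbits (𝒢.isClosed_stab T v) (fun x => ?_) (fun x => ?_)
  · obtain ⟨w, g, rfl⟩ := 𝒢.mkV_surj T x
    have hfin := finite_orbit_of_relIndex g (𝒢.commensurable_conj_vertSub T w v g).1
    refine (hfin.image (Sigma.mk w)).subset ?_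
    rintro _ ⟨k, hk, rfl⟩
    obtain ⟨a, ha⟩ := 𝒢.exists_vert_mem T
      ((𝒢.cover T).isOpen_onV (𝒢.mkV T w g) (k.onV _)) hk rfl
    exact ⟨_, ⟨_, ⟨a, rfl⟩, rfl⟩, ha⟩
  · obtain ⟨e, g, rfl⟩ := 𝒢.mkE_surj T x
    have hfin := finite_orbit_of_relIndex g (((𝒢.commensurable_edgeSub T e).conj
      (ConjAct.toConjAct g)).trans (𝒢.commensurable_conj_vertSub T _ v g)).1
    refine (hfin.image (Sigma.mk e)).subset ?_
    rintro _ ⟨k, hk, rfl⟩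
    obtain ⟨a, ha⟩ := 𝒢.exists_vert_mem T
      ((𝒢.cover T).isOpen_onE (𝒢.mkE T e g) (k.onE _)) hk rfl
    exact ⟨_, ⟨_, ⟨a, rfl⟩, rfl⟩, ha⟩

end ZnGraph

/-! ### Semidirect products and integral points -/

section Semidirect

variable {N K : Type*} [Group N] [Group K] [TopologicalSpace N] [TopologicalSpace K]
  (θ : K →* MulAut N)

lemma continuous_semidirect_left : Continuous (fun x : N ⋊[θ] K => x.left) :=
  continuous_fst.comp
    (continuous_induced_dom (f := fun x : N ⋊[θ] K => (x.left, x.right)))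

lemma continuous_semidirect_inl : Continuous (SemidirectProduct.inl : N →* N ⋊[θ] K) :=
  continuous_induced_rng.2 (continuous_id.prodMk continuous_const)

end Semidirect

/-- The inclusion of `ℤⁿ` in `ℝⁿ`. -/
def intVec {n : ℕ} (a : ZZ n) : RR n := Multiplicative.ofAdd fun i => ((a.toAdd i : ℤ) : ℝ)

/-- Properness of `ℤ → ℝ` passes to finite products, where the cofinite and cocompact filters are
the coproducts of those of the factors. -/
lemma tendsto_intVec (n : ℕ) :
    Filter.Tendsto (intVec : ZZ n → RR n) Filter.cofinite (Filter.cocompact (RR n)) := by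
  have h : Filter.Tendsto (fun (a : Fin n → ℤ) i => ((a i : ℤ) : ℝ))
      (Filter.coprodᵢ fun _ => Filter.cofinite) (Filter.coprodᵢ fun _ => Filter.cocompact ℝ) :=
    Filter.Tendsto.pi_map_coprodᵢ fun _ => Int.tendsto_coe_cofinite
  rw [Filter.coprodᵢ_cofinite, Filter.coprodᵢ_cocompact] at h
  exact h

lemma finite_intVec_mem {n : ℕ} {S : Set (RR n)} (hS : IsCompact S) :
    {a : ZZ n | intVec a ∈ S}.Finite := by
  have h := tendsto_intVec n hS.compl_mem_cocompact
  rw [Filter.mem_map, Filter.mem_cofinite] at h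
  rwa [← Set.preimage_compl, compl_compl] at h

/-- The points of `ℝⁿ` all of whose coordinates are less than `1` in absolute value. -/
def unitBox (n : ℕ) : Set (RR n) := Multiplicative.toAdd ⁻¹' Metric.ball (0 : Fin n → ℝ) 1

lemma isOpen_unitBox (n : ℕ) : IsOpen (unitBox n) :=
  Metric.isOpen_ball.preimage continuous_toAdd

lemma eq_one_of_intVec_mem {n : ℕ} {a : ZZ n} (h : intVec a ∈ unitBox n) : a = 1 := by
  apply Multiplicative.toAdd.injective
  funext i
  have h1 := (norm_le_pi_norm (fun i => ((a.toAdd i : ℤ) : ℝ)) i).trans_lt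
    (mem_ball_zero_iff.1 h)
  rw [Real.norm_eq_abs, ← Int.cast_abs] at h1
  exact Int.abs_lt_one_iff.1 (by exact_mod_cast h1)

/-- The closed unit cube. -/
def unitCube (n : ℕ) : Set (RR n) := Multiplicative.toAdd ⁻¹' Set.Icc (0 : Fin n → ℝ) 1

lemma isCompact_unitCube (n : ℕ) : IsCompact (unitCube n) :=
  isCompact_Icc (a := (0 : Fin n → ℝ)) (b := 1)

lemma exists_mul_intVec_mem {n : ℕ} (x : RR n) : ∃ a, x * intVec a ∈ unitCube n := by
  -- Subtracting the floors leaves the fractional parts.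
  refine ⟨Multiplicative.ofAdd fun i => -⌊x.toAdd i⌋, ?_, ?_⟩
  · intro i
    simpa [intVec] using Int.floor_le (x.toAdd i)
  · intro i
    have : x.toAdd i - ⌊x.toAdd i⌋ ≤ 1 := (Int.fract_lt_one _).le
    simpa [intVec, sub_eq_add_neg, -tsub_le_iff_right] using this

/-! ### Injectivity, discreteness, cocompactness and properness -/

namespace ZnGraph

open Matrix

lemma continuous_glAct {n : ℕ} (M : GL (Fin n) ℝ) : Continuous (glAct n M) :=
  continuous_ofAdd.comp ((Continuous.matrix_mulVec continuous_const continuous_id).comp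
    continuous_toAdd)

variable {n : ℕ} {V E : Type*} (𝒢 : ZnGraph n V E) (T : 𝒢.toOGraph.MaxTree)
  (A : 𝒢.toOGraph.Orientation) (v₀ : V)

lemma τ_self : 𝒢.τ T v₀ v₀ = 1 := by
  rw [τ, ← 𝒢.eq_treePath T (p := []) rfl List.isChain_nil (by simp)]
  rfl

/-- The normalization `τ v₀ = 1` makes the base vertex group act as the standard lattice. -/
lemma μ_vert (a : ZZ n) : 𝒢.μ T v₀ (𝒢.vert T v₀ a) = SemidirectProduct.inl (intVec a) := by
  have h : 𝒢.vertVec T v₀ v₀ a = intVec a := by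
    simp [vertVec, τ_self, intVec]
  simp [μ, h]

lemma ν_vert (a : ZZ n) : 𝒢.ν T A v₀ (𝒢.vert T v₀ a) = SemidirectProduct.inl (intVec a) := by
  refine SemidirectProduct.ext ?_ ?_
  · change (𝒢.μ T v₀ (𝒢.vert T v₀ a)).left = _
    rw [μ_vert]; rfl
  · exact 𝒢.φ_vert T A v₀ a

/-- The translation part of `γ a` determines the element `a` of the base vertex group. -/
def recover (γ : 𝒢.FundGroup T) (x : RR n) : RR n :=
  glAct n (𝒢.μ T v₀ γ).right⁻¹ ((𝒢.μ T v₀ γ).left⁻¹ * x)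

lemma continuous_recover (γ : 𝒢.FundGroup T) : Continuous (𝒢.recover T v₀ γ) :=
  (continuous_glAct _).comp (continuous_const.mul continuous_id)

/-- If `μ γ = (x, M)`, then `μ (γ a)` has translation part `x + M a`, and `recover` applies `y ↦ M⁻¹
(y - x)`. -/
lemma recover_μ (γ : 𝒢.FundGroup T) (a : ZZ n) :
    𝒢.recover T v₀ γ (𝒢.μ T v₀ (γ * 𝒢.vert T v₀ a)).left = intVec a := by
  rw [map_mul, μ_vert, recover]
  simp

/-- The common source of injectivity and discreteness: `δ = γ a` by the first hypothesis, and `a` is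
an integer vector in the open unit box. -/
lemma eq_of_mem {γ δ : 𝒢.FundGroup T}
    (h : (𝒢.ι T δ).onV (𝒢.mkV T v₀ 1) = (𝒢.ι T γ).onV (𝒢.mkV T v₀ 1))
    (h' : 𝒢.recover T v₀ γ (𝒢.μ T v₀ δ).left ∈ unitBox n) : δ = γ := by
  obtain ⟨a, rfl⟩ := (𝒢.onV_mkV_eq_iff T).1 h
  rw [recover_μ] at h'
  rw [eq_one_of_intVec_mem h', map_one, mul_one]

lemma one_mem_unitBox : (1 : RR n) ∈ unitBox n :=
  Metric.mem_ball_self one_pos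

lemma recover_self (γ : 𝒢.FundGroup T) : 𝒢.recover T v₀ γ (𝒢.μ T v₀ γ).left = 1 := by
  simp [recover]

lemma injective_ι_ν : Function.Injective ((𝒢.ι T).prod (𝒢.ν T A v₀)) := by
  intro δ γ h
  have h1 : 𝒢.ι T δ = 𝒢.ι T γ := congrArg Prod.fst h
  have h2 : (𝒢.μ T v₀ δ).left = (𝒢.μ T v₀ γ).left :=
    congrArg (fun p => SemidirectProduct.left (Prod.snd p)) h
  refine 𝒢.eq_of_mem T v₀ (by rw [h1]) ?_
  rw [h2, recover_self]
  exact one_mem_unitBox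

lemma ι_mem_closureι (γ : 𝒢.FundGroup T) : 𝒢.ι T γ ∈ 𝒢.closureι T :=
  subset_closure ⟨γ, rfl⟩

lemma ι_ν_mem_W (γ : 𝒢.FundGroup T) : (𝒢.ι T).prod (𝒢.ν T A v₀) γ ∈ 𝒢.W T A v₀ :=
  ⟨𝒢.ι_mem_closureι T γ, 𝒢.φbar_ι T A v₀ γ _⟩

lemma range_le_W : ((𝒢.ι T).prod (𝒢.ν T A v₀)).range ≤ 𝒢.W T A v₀ := by
  rintro _ ⟨γ, rfl⟩
  exact 𝒢.ι_ν_mem_W T A v₀ γ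

lemma discreteTopology_range :
    DiscreteTopology (((𝒢.ι T).prod (𝒢.ν T A v₀)).range.subgroupOf (𝒢.W T A v₀)) := by
  rw [discreteTopology_iff_isOpen_singleton]
  rintro ⟨⟨p, hW⟩, hp⟩
  obtain ⟨γ, hγ⟩ := id hp
  change (𝒢.ι T).prod (𝒢.ν T A v₀) γ = p at hγ
  subst hγ
  -- By `eq_of_mem`, this open set meets the image of the fundamental group only in the image of
  -- `γ`.
  have hU : IsOpen {p : (𝒢.cover T).Aut × 𝒢.SemiH T A v₀ |
      p.1.onV (𝒢.mkV T v₀ 1) = (𝒢.ι T γ).onV (𝒢.mkV T v₀ 1) ∧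
      𝒢.recover T v₀ γ p.2.left ∈ unitBox n} :=
    (((𝒢.cover T).isOpen_onV _ _).preimage continuous_fst).inter
      ((isOpen_unitBox n).preimage ((𝒢.continuous_recover T v₀ γ).comp
        ((continuous_semidirect_left _).comp continuous_snd)))
  convert! hU.preimage (continuous_subtype_val.comp continuous_subtype_val) using 1
  ext ⟨⟨q, hW'⟩, hq⟩
  obtain ⟨δ, hδ⟩ := id hq
  change (𝒢.ι T).prod (𝒢.ν T A v₀) δ = q at hδ
  subst hδ
  constructor
  · intro h
    have h1 : (𝒢.ι T).prod (𝒢.ν T A v₀) δ = (𝒢.ι T).prod (𝒢.ν T A v₀) γ :=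
      congrArg (fun x => x.1.1) h
    obtain rfl := 𝒢.injective_ι_ν T A v₀ h1
    refine ⟨rfl, ?_⟩
    change 𝒢.recover T v₀ δ (𝒢.μ T v₀ δ).left ∈ unitBox n
    rw [recover_self]
    exact one_mem_unitBox
  · rintro ⟨h1, h2⟩
    obtain rfl := 𝒢.eq_of_mem T v₀ h1 h2
    rfl

lemma φbar_eq_one_of_mem_stab {g : (𝒢.cover T).Aut} (hg : g ∈ 𝒢.stab T v₀) :
    𝒢.φbar T A v₀ ⟨g, hg.1⟩ = 1 := by
  change 𝒢.label T A (g.onV (𝒢.mkV T v₀ 1)) * (𝒢.label T A (𝒢.mkV T v₀ 1))⁻¹ = 1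
  rw [hg.2, mul_inv_cancel]

/-- The product of the stabilizer of the base vertex and of the unit cube, a compact subset of
`W` whose translates by the fundamental group cover `W`. -/
def fundDomain : Set (𝒢.W T A v₀) :=
  {p | p.1.1 ∈ 𝒢.stab T v₀ ∧ p.1.2 ∈ SemidirectProduct.inl '' unitCube n}

lemma isCompact_fundDomain : IsCompact (𝒢.fundDomain T A v₀) := by
  rw [Subtype.isCompact_iff]
  -- Membership in `W` is automatic here, as both factors map trivially to `H_d`; so the set is a
  -- genuine product of compact sets.
  have h : Subtype.val '' 𝒢.fundDomain T A v₀ =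
      (𝒢.stab T v₀ : Set (𝒢.cover T).Aut) ×ˢ
        ((SemidirectProduct.inl : RR n →* 𝒢.SemiH T A v₀) '' unitCube n) := by
    ext p
    constructor
    · rintro ⟨p, hp, rfl⟩
      exact hp
    · rintro ⟨h1, h2⟩
      refine ⟨⟨p, h1.1, ?_⟩, ⟨h1, h2⟩, rfl⟩
      obtain ⟨x, -, hx⟩ := h2
      rw [← hx]
      exact 𝒢.φbar_eq_one_of_mem_stab T A v₀ h1
  rw [h]
  exact (𝒢.isCompact_stab T v₀).prod ((isCompact_unitCube n).image (continuous_semidirect_inl _))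

/-- By density some `γ` agrees with `g⁻¹` at the base vertex. -/
lemma exists_mul_mem_stab {g : (𝒢.cover T).Aut} (hg : g ∈ 𝒢.closureι T) :
    ∃ γ, g * 𝒢.ι T γ ∈ 𝒢.stab T v₀ := by
  obtain ⟨γ, hγ⟩ := 𝒢.exists_ι_mem T
    ((𝒢.cover T).isOpen_onV (𝒢.mkV T v₀ 1) (g⁻¹.onV (𝒢.mkV T v₀ 1))) (inv_mem hg) rfl
  refine ⟨γ, mul_mem hg (𝒢.ι_mem_closureι T γ), ?_⟩
  rw [OGraph.Aut.onV_mul, show (𝒢.ι T γ).onV _ = _ from hγ, ← OGraph.Aut.onV_mul, mul_inv_cancel,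
    OGraph.Aut.onV_one]

lemma exists_mul_mem_fundDomain (p : 𝒢.W T A v₀) :
    ∃ γ, p * ⟨_, 𝒢.ι_ν_mem_W T A v₀ γ⟩ ∈ 𝒢.fundDomain T A v₀ := by
  obtain ⟨γ, hγ⟩ := 𝒢.exists_mul_mem_stab T v₀ p.2.1
  set q : 𝒢.W T A v₀ := p * ⟨_, 𝒢.ι_ν_mem_W T A v₀ γ⟩ with hq
  have hq1 : q.1.1 ∈ 𝒢.stab T v₀ := hγ
  -- The fiber product condition: an element fixing the base vertex has trivial `φbar`, so only a
  -- translation is left.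
  have hq2 : q.1.2.right = 1 := by
    rw [← 𝒢.φbar_eq_one_of_mem_stab T A v₀ hq1]
    exact q.2.2.symm
  have hq3 : q.1.2 = SemidirectProduct.inl q.1.2.left := SemidirectProduct.ext rfl hq2
  obtain ⟨a, ha⟩ := exists_mul_intVec_mem q.1.2.left
  refine ⟨γ * 𝒢.vert T v₀ a, ?_⟩
  have h : (p * ⟨_, 𝒢.ι_ν_mem_W T A v₀ (γ * 𝒢.vert T v₀ a)⟩ : 𝒢.W T A v₀) =
      q * ⟨_, 𝒢.ι_ν_mem_W T A v₀ (𝒢.vert T v₀ a)⟩ := by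
    rw [hq, mul_assoc]
    congr 1
    exact Subtype.ext (map_mul _ _ _)
  rw [h]
  -- The correction by `a` fixes the base vertex, so the first component stays in the stabilizer.
  refine ⟨mul_mem hq1 ⟨𝒢.ι_mem_closureι T _, ?_⟩, _, ha, ?_⟩
  · have := (𝒢.onV_mkV_eq_iff T (g := 𝒢.vert T v₀ a) (h := 1) (v := v₀)).2 ⟨a, by rw [one_mul]⟩
    rwa [map_one] at this
  · change _ = q.1.2 * 𝒢.ν T A v₀ (𝒢.vert T v₀ a)
    rw [ν_vert, map_mul, ← hq3]

lemma compactSpace_quotient :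
    CompactSpace (𝒢.W T A v₀ ⧸ ((𝒢.ι T).prod (𝒢.ν T A v₀)).range.subgroupOf (𝒢.W T A v₀)) := by
  refine ⟨?_⟩
  convert (𝒢.isCompact_fundDomain T A v₀).image
    (f := ((↑) : 𝒢.W T A v₀ → 𝒢.W T A v₀ ⧸
      ((𝒢.ι T).prod (𝒢.ν T A v₀)).range.subgroupOf (𝒢.W T A v₀))) continuous_quotient_mk'
  refine (Set.eq_univ_of_forall fun x => ?_).symm
  obtain ⟨p, rfl⟩ := QuotientGroup.mk_surjective x
  obtain ⟨γ, hγ⟩ := 𝒢.exists_mul_mem_fundDomain T A v₀ p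
  exact ⟨_, hγ, QuotientGroup.mk_mul_of_mem p ⟨γ, rfl⟩⟩

lemma tendsto_ι_μ : Filter.Tendsto ((𝒢.ι T).prod (𝒢.μ T v₀)) Filter.cofinite
    (Filter.cocompact ((𝒢.cover T).Aut × (RR n ⋊[glAct n] GL (Fin n) ℝ))) := by
  intro S hS
  obtain ⟨K, hK, hKS⟩ := Filter.mem_cocompact.1 hS
  rw [Filter.mem_map, Filter.mem_cofinite]
  have hfin := (𝒢.cover T).finite_onV_image (hK.image continuous_fst) (𝒢.mkV T v₀ 1)
  have hpre : ((𝒢.ι T).prod (𝒢.μ T v₀) ⁻¹' K).Finite := by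
    -- Sort the elements by their image of the base vertex: finitely many images occur, and each
    -- fiber lies in one coset `γ G_{v₀}`, where `recover` turns it into integer points of a compact
    -- set.
    refine Set.Finite.of_finite_fibers (fun γ => (𝒢.ι T γ).onV (𝒢.mkV T v₀ 1))
      (hfin.subset ?_) ?_
    · rintro _ ⟨γ, hγ, rfl⟩
      exact ⟨𝒢.ι T γ, ⟨_, hγ, rfl⟩, rfl⟩
    · rintro _ ⟨γ, hγ, rfl⟩
      have hc : IsCompact ((fun p : (𝒢.cover T).Aut × (RR n ⋊[glAct n] GL (Fin n) ℝ) =>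
          𝒢.recover T v₀ γ p.2.left) '' K) :=
        hK.image ((𝒢.continuous_recover T v₀ γ).comp
          ((continuous_semidirect_left _).comp continuous_snd))
      refine ((finite_intVec_mem hc).image fun a => γ * 𝒢.vert T v₀ a).subset ?_
      rintro δ ⟨hδ, hδγ⟩
      obtain ⟨a, rfl⟩ := (𝒢.onV_mkV_eq_iff T).1 hδγ
      exact ⟨a, ⟨_, hδ, 𝒢.recover_μ T v₀ γ a⟩, rfl⟩
  exact hpre.subset fun γ hγ => by_contra fun h => hγ (hKS h)

end ZnGraph

end GraphZn

end

theorem mainTheorem7 {V E : Type*} [Finite V] [Finite E] {n : ℕ}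
    (𝒢 : GraphZn.ZnGraph n V E) (T : 𝒢.toOGraph.MaxTree) (A : 𝒢.toOGraph.Orientation) (v₀ : V) :
    Function.Injective ((𝒢.ι T).prod (𝒢.ν T A v₀)) ∧
    ((𝒢.ι T).prod (𝒢.ν T A v₀)).range ≤ 𝒢.W T A v₀ ∧
    GraphZn.IsCocompactLattice
      (((𝒢.ι T).prod (𝒢.ν T A v₀)).range.subgroupOf (𝒢.W T A v₀)) ∧
    Filter.Tendsto ((𝒢.ι T).prod (𝒢.μ T v₀)) Filter.cofinite
      (Filter.cocompact ((𝒢.cover T).Aut ×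
        (GraphZn.RR n ⋊[GraphZn.ZnGraph.glAct n] GL (Fin n) ℝ))) :=
  ⟨𝒢.injective_ι_ν T A v₀, 𝒢.range_le_W T A v₀,
    ⟨𝒢.discreteTopology_range T A v₀, 𝒢.compactSpace_quotient T A v₀⟩, 𝒢.tendsto_ι_μ T v₀⟩
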